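/- Let $d\in\mathbb N$, let $\mathbb Z_-=\{\dots,-2,-1,0\}$, let $p\in[1,\infty]$ with Hölder conjugate $q$, and let $\ell^p,\ell^q$ be the usual spaces of real sequences indexed by $\mathbb N$; for $\mathbf a\in\ell^p$, $\mathbf x\in\ell^q$ write $\mathbf a\cdot\mathbf x=\sum_i a_ix_i$. For $D_d\subset\mathbb R^d$ let $\ell^\infty_-(D_d)$ be the set of sequences $\mathbf z=(\mathbf z_t)_{t\in\mathbb Z_-}$ with all $\mathbf z_t\in D_d$ and $\sup_t\|\mathbf z_t\|<\infty$, and let $\mathcal I_d\subset\ell^\infty_-(D_d)$, equipped with the trace of the product $\sigma$-algebra of $(\mathbb R^d)^{\mathbb Z_-}$. Let $\sigma_1,\sigma_2\colon\mathbb R\to\mathbb R$. Let $\mathcal C$ be the class of recurrent (generalized) Barron functionals, that is, of all $H\colon\mathcal I_d\to\mathbb R$ for which there exist a Borel probability measure $\mu$ on $\mathcal X=\mathbb R\times\ell^p\times\mathbb R^d\times\mathbb R$, some $\mathbf B\in\ell^q$ and linear maps $A\colon\ell^q\to\ell^q$, $C\colon\mathbb R^d\to\ell^q$ such that (i) for each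 $\mathbf z\in\mathcal I_d$ the system $$\mathbf x_t=\sigma_1(A\mathbf x_{t-1}+C\mathbf z_t+\mathbf B),\qquad t\in\mathbb Z_-,$$ with $\sigma_1$ applied componentwise, has a unique solution $(\mathbf x_t(\mathbf z))_{t\in\mathbb Z_-}$ in $(\ell^q)^{\mathbb Z_-}$ with $\sup_t\|\mathbf x_t(\mathbf z)\|_q<\infty$; (ii) $\int_{\mathcal X}|w|(\|\mathbf a\|_p+\|\mathbf c\|+|b|)\,\mu(dw,d\mathbf a,d\mathbf c,db)<\infty$; and (iii) for each $\mathbf z\in\mathcal I_d$, $$H(\mathbf z)=\int_{\mathcal X}w\,\sigma_2(\mathbf a\cdot\mathbf x_{-1}(\mathbf z)+\mathbf c\cdot\mathbf z_0+b)\,\mu(dw,d\mathbf a,d\mathbf c,db),$$ where the integrand is $\mu$-integrable. Assume that $\sigma_1(x)=x$ for all $x$, and that either $\sigma_2(x)=\max(x,0)$ for all $x$, or $\sigma_2$ is bounded, continuous and non-constant. Let $\bar p\in[1,\infty)$ and let $\gamma$ be a probability measure on $\mathcal I_d$. Then $\mathcal C\cap L^{\bar p}(\mathcal I_d,\gamma)$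 is dense in $L^{\bar p}(\mathcal I_d,\gamma)$. -/

import Mathlib

open MeasureTheory
open scoped ENNReal

noncomputable section

namespace RecurrentBarron

/-- The non-positive integers `ℤ₋ = {…, -2, -1, 0}`. -/
abbrev ZMinus : Type := {t : ℤ // t ≤ 0}

/-- The time `0`. -/
def ZMinus.zero : ZMinus := ⟨0, le_refl 0⟩

/-- The predecessor `t - 1` of a time `t ∈ ℤ₋`. -/
def ZMinus.pred (t : ZMinus) : ZMinus := ⟨t.1 - 1, by have := t.2; omega⟩

/-- The real sequence space `ℓ^r`, indexed by `ℕ`. -/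
abbrev SeqSpace (r : ℝ≥0∞) : Type := lp (fun _ : ℕ => ℝ) r

/-- Input sequences `(ℝ^d)^{ℤ₋}`, with the product `σ`-algebra. -/
abbrev InputSeq (d : ℕ) : Type := ZMinus → EuclideanSpace ℝ (Fin d)

/-- `ℓ^∞₋(D)`: the sequences `z ∈ D^{ℤ₋}` with `sup_t ‖z_t‖ < ∞`. -/
def boundedInputs {d : ℕ} (D : Set (EuclideanSpace ℝ (Fin d))) : Set (InputSeq d) :=
  {z | (∀ t, z t ∈ D) ∧ BddAbove (Set.range fun t => ‖z t‖)}

/-- The parameter space `ℝ × ℓ^p × ℝ^d × ℝ` of tuples `(w, a, c, b)`. It is a `def` so that it can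
carry the Borel `σ`-algebra of the product topology, which for `p = ∞` need not agree with the
product `σ`-algebra. -/
def ParamSpace (p : ℝ≥0∞) (d : ℕ) : Type :=
  ℝ × SeqSpace p × EuclideanSpace ℝ (Fin d) × ℝ

instance (p : ℝ≥0∞) [Fact (1 ≤ p)] (d : ℕ) : TopologicalSpace (ParamSpace p d) :=
  inferInstanceAs (TopologicalSpace (ℝ × SeqSpace p × EuclideanSpace ℝ (Fin d) × ℝ))

instance (p : ℝ≥0∞) [Fact (1 ≤ p)] (d : ℕ) : MeasurableSpace (ParamSpace p d) :=
  borel (ParamSpace p d)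

instance (p : ℝ≥0∞) [Fact (1 ≤ p)] (d : ℕ) : BorelSpace (ParamSpace p d) := ⟨rfl⟩

namespace ParamSpace

variable {p : ℝ≥0∞} {d : ℕ}

/-- The output weight `w`. -/
def w (θ : ParamSpace p d) : ℝ := θ.1

/-- The state weight `a ∈ ℓ^p`. -/
def a (θ : ParamSpace p d) : SeqSpace p := θ.2.1

/-- The input weight `c ∈ ℝ^d`. -/
def c (θ : ParamSpace p d) : EuclideanSpace ℝ (Fin d) := θ.2.2.1

/-- The bias `b`. -/
def b (θ : ParamSpace p d) : ℝ := θ.2.2.2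

end ParamSpace

/-- The pairing `a · x = ∑ i, a_i x_i` of `a ∈ ℓ^p` and `x ∈ ℓ^q`. -/
def pairing {p q : ℝ≥0∞} (a : SeqSpace p) (x : SeqSpace q) : ℝ := ∑' i : ℕ, a i * x i

/-- `x` belongs to `ℓ^∞₋(ℓ^q)` and solves `x_t = σ₁(A x_{t-1} + C z_t + B)` for all `t ∈ ℤ₋`, where
`σ₁` acts componentwise. -/
def IsBoundedSolution {q : ℝ≥0∞} {d : ℕ} (σ₁ : ℝ → ℝ)
    (A : SeqSpace q →ₗ[ℝ] SeqSpace q) (C : EuclideanSpace ℝ (Fin d) →ₗ[ℝ] SeqSpace q)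
    (B : SeqSpace q) (z : InputSeq d) (x : ZMinus → SeqSpace q) : Prop :=
  BddAbove (Set.range fun t => ‖x t‖) ∧
    ∀ (t : ZMinus) (i : ℕ), x t i = σ₁ ((A (x t.pred) + C (z t) + B) i)

/-- The class `𝒞` of recurrent (generalized) Barron functionals `H : I → ℝ`, for activation
functions `σ₁, σ₂` and state space `ℓ^q`. That the integral defining `H z` converges is part of the
definition. -/
def barronClass (p q : ℝ≥0∞) [Fact (1 ≤ p)] (σ₁ σ₂ : ℝ → ℝ) {d : ℕ} (I : Set (InputSeq d)) :
    Set (I → ℝ) :=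
  {H | ∃ (μ : Measure (ParamSpace p d)) (B : SeqSpace q)
      (A : SeqSpace q →ₗ[ℝ] SeqSpace q) (C : EuclideanSpace ℝ (Fin d) →ₗ[ℝ] SeqSpace q),
    IsProbabilityMeasure μ ∧
    (∀ z : I, ∃! x : ZMinus → SeqSpace q, IsBoundedSolution σ₁ A C B z x) ∧
    ∫⁻ θ, ENNReal.ofReal (|θ.w| * (‖θ.a‖ + ‖θ.c‖ + |θ.b|)) ∂μ < ∞ ∧
    ∀ (z : I) (x : ZMinus → SeqSpace q), IsBoundedSolution σ₁ A C B z x →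
      Integrable (fun θ : ParamSpace p d => θ.w *
        σ₂ (pairing θ.a (x ZMinus.zero.pred) + inner ℝ θ.c (z.1 ZMinus.zero) + θ.b)) μ ∧
      H z = ∫ θ, θ.w *
        σ₂ (pairing θ.a (x ZMinus.zero.pred) + inner ℝ θ.c (z.1 ZMinus.zero) + θ.b) ∂μ}

end RecurrentBarron

end

/-
By Hahn–Banach, it suffices that a functional on `L^r(γ)` is zero if it vanishes on the networks.
On bounded functions it is integration against some `g ∈ L¹(γ)`, so `∫ g τ(sℓ + b) dγ = 0` for all
`s`, `b` and all features `ℓ`, where `τ` is a bounded, continuous, non-constant profile: `σ₂`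
itself, or the difference `(x + 1)₊ - x₊` of two ReLUs. The profiles annihilated in this way are
stable under differences and averages of dilations. A second difference of `τ` has a bounded second
antiderivative, so integrating by parts twice in the dilation parameter turns it into a profile that
decays like `t⁻²`, and it can be kept non-zero. The Fourier transform in `b` of this integrable
profile gives `∫ g e^{iℓ} dγ = 0` for all features `ℓ`, hence `g = 0`, because the features
generate the `σ`-algebra.

The features come from a single linear recurrence, a delay line that stores the whole past of the
input with geometrically decaying weights. A finite sum of neurons reading it is a Barron functional
whose `μ` is a normalized counting measure, the output weights being scaled up to compensate.
-/

noncomputable section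

namespace RecurrentBarron

section FiniteDifference

open scoped fwdDiff

variable {E : Type*} [NormedAddCommGroup E]

lemma norm_fwdDiff_le_add {A : Type*} [AddCommGroup A] {f : A → E} {M : ℝ} (hM : ∀ x, ‖f x‖ ≤ M)
    (h x : A) : ‖Δ_[h] f x‖ ≤ M + M :=
  norm_sub_le_of_le (hM _) (hM _)

variable [NormedSpace ℝ E]

lemma hasDerivAt_fwdDiff {F F' : ℝ → E} (hF : ∀ x, HasDerivAt F (F' x) x) (h x : ℝ) :
    HasDerivAt (Δ_[h] F) (Δ_[h] F' x) x :=
  ((hF (x + h)).comp_add_const x h).sub (hF x)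

lemma norm_fwdDiff_le_mul_abs {F F' : ℝ → E} (hF : ∀ x, HasDerivAt F (F' x) x) {C : ℝ}
    (hC : ∀ x, ‖F' x‖ ≤ C) (h x : ℝ) : ‖Δ_[h] F x‖ ≤ C * |h| := by
  simpa [fwdDiff] using convex_univ.norm_image_sub_le_of_norm_hasDerivWithin_le
    (fun y _ => (hF y).hasDerivWithinAt) (fun y _ => hC y) (Set.mem_univ x) (Set.mem_univ (x + h))

lemma exists_bounded_second_antiderivative_fwdDiff [CompleteSpace E] {f : ℝ → E}
    (hf : Continuous f) {M : ℝ} (hM : ∀ x, ‖f x‖ ≤ M) (h : ℝ) :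
    ∃ K K' : ℝ → E, (∀ x, HasDerivAt K (K' x) x) ∧
      (∀ x, HasDerivAt K' (Δ_[h] (Δ_[h] f) x) x) ∧ ∃ C, ∀ x, ‖K x‖ ≤ C := by
  set P : ℝ → E := fun x => ∫ y in (0 : ℝ)..x, f y
  have hP : ∀ x, HasDerivAt P (f x) x := fun x => hf.integral_hasStrictDerivAt 0 x |>.hasDerivAt
  have hPc : Continuous P := continuous_iff_continuousAt.2 fun x => (hP x).continuousAt
  set Q : ℝ → E := fun x => ∫ y in (0 : ℝ)..x, P y
  have hQ : ∀ x, HasDerivAt Q (P x) x := fun x => hPc.integral_hasStrictDerivAt 0 x |>.hasDerivAt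
  exact ⟨Δ_[h] (Δ_[h] Q), Δ_[h] (Δ_[h] P),
    hasDerivAt_fwdDiff (hasDerivAt_fwdDiff hQ h) h, hasDerivAt_fwdDiff (hasDerivAt_fwdDiff hP h) h,
    M * |h| * |h|,
    norm_fwdDiff_le_mul_abs (hasDerivAt_fwdDiff hQ h) (norm_fwdDiff_le_mul_abs hP hM h) h⟩

lemma exists_fwdDiff_fwdDiff_ne_zero {A : Type*} [AddCommGroup A] {f : A → E} {M : ℝ}
    (hM : ∀ x, ‖f x‖ ≤ M) (hf : ∃ x y, f x ≠ f y) : ∃ h x, Δ_[h] (Δ_[h] f) x ≠ 0 := by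
  by_contra! hzero
  obtain ⟨x, y, hxy⟩ := hf
  set h := y - x
  have hslope : ∀ n : ℕ, Δ_[h] f (x + n • h) = Δ_[h] f x := by
    intro n
    induction n with
    | zero => simp
    | succ n ih => rw [succ_nsmul, ← add_assoc, sub_eq_zero.1 (hzero h (x + n • h)), ih]
  have hprogression : ∀ n : ℕ, f (x + n • h) = f x + n • Δ_[h] f x := by
    intro n
    induction n with
    | zero => simp
    | succ n ih =>
      calc f (x + (n + 1) • h) = f (x + n • h) + Δ_[h] f (x + n • h) := by
            rw [fwdDiff, add_sub_cancel, succ_nsmul, add_assoc]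
        _ = f x + (n + 1) • Δ_[h] f x := by rw [ih, hslope, succ_nsmul, add_assoc]
  have hne : Δ_[h] f x ≠ 0 := by simpa [fwdDiff, h, sub_eq_zero] using hxy.symm
  obtain ⟨n, hn⟩ := Archimedean.arch (2 * M + 1) (norm_pos_iff.2 hne)
  have hle : n • ‖Δ_[h] f x‖ ≤ M + M := by
    rw [← RCLike.norm_nsmul ℝ, ← add_sub_cancel_left (f x) (n • _), ← hprogression n]
    exact norm_sub_le_of_le (hM _) (hM _)
  linarith

end FiniteDifference

section DilationAverage

open scoped ContDiff fwdDiff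

/-- The average over `s`, with weight `χ`, of the dilations `t ↦ f (s * t)` of `f`. -/
def dilationAverage (χ f : ℝ → ℝ) (t : ℝ) : ℝ := ∫ s, χ s * f (s * t)

variable {χ f : ℝ → ℝ} {M : ℝ}

lemma norm_dilationAverage_le (hχ : Integrable χ) (hM : ∀ x, ‖f x‖ ≤ M) (t : ℝ) :
    ‖dilationAverage χ f t‖ ≤ (∫ s, ‖χ s‖) * M := by
  rw [← integral_mul_const]
  refine norm_integral_le_of_norm_le (f := fun s => χ s * f (s * t)) (hχ.norm.mul_const M)
    (.of_forall fun s => ?_)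
  rw [norm_mul]
  exact mul_le_mul_of_nonneg_left (hM _) (norm_nonneg _)

lemma continuous_dilationAverage (hχ : Integrable χ) (hf : Continuous f) (hM : ∀ x, ‖f x‖ ≤ M) :
    Continuous (dilationAverage χ f) := by
  refine continuous_of_dominated (bound := fun s => ‖χ s‖ * M)
    (fun t => hχ.1.mul (by fun_prop)) (fun t => .of_forall fun s => ?_) (hχ.norm.mul_const M)
    (.of_forall fun s => by fun_prop)
  rw [norm_mul]
  exact mul_le_mul_of_nonneg_left (hM _) (norm_nonneg _)

lemma mul_dilationAverage_deriv {F F' : ℝ → ℝ} (hχ : ContDiff ℝ 1 χ) (hχc : HasCompactSupport χ)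
    (hF : ∀ x, HasDerivAt F (F' x) x) (hF' : Continuous F') (t : ℝ) :
    t * dilationAverage χ F' t = -dilationAverage (deriv χ) F t := by
  have hFc : Continuous F := continuous_iff_continuousAt.2 fun x => (hF x).continuousAt
  have hχ' : Continuous (deriv χ) := hχ.continuous_deriv le_rfl
  have hdilate : ∀ s, HasDerivAt (fun s => F (s * t)) (F' (s * t) * t) s := fun s =>
    (hF (s * t)).comp s (hasDerivAt_mul_const t)
  have hparts := integral_mul_deriv_eq_deriv_mul_of_integrable
    (fun s _ => (hχ.differentiable one_ne_zero s).hasDerivAt) (fun s _ => hdilate s)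
    ((hχ.continuous.mul (by fun_prop)).integrable_of_hasCompactSupport hχc.mul_right)
    ((hχ'.mul (by fun_prop)).integrable_of_hasCompactSupport hχc.deriv.mul_right)
    ((hχ.continuous.mul (by fun_prop)).integrable_of_hasCompactSupport hχc.mul_right)
  rw [dilationAverage, dilationAverage, ← hparts, ← integral_const_mul]
  congr 1 with s
  ring

lemma sq_mul_dilationAverage_deriv_deriv {K K' K'' : ℝ → ℝ} (hχ : ContDiff ℝ 2 χ)
    (hχc : HasCompactSupport χ) (hK : ∀ x, HasDerivAt K (K' x) x)
    (hK' : ∀ x, HasDerivAt K' (K'' x) x) (hK'' : Continuous K'') (t : ℝ) :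
    t ^ 2 * dilationAverage χ K'' t = dilationAverage (deriv (deriv χ)) K t := by
  have hK'c : Continuous K' := continuous_iff_continuousAt.2 fun x => (hK' x).continuousAt
  have hχ' : ContDiff ℝ 1 (deriv χ) := ((contDiff_succ_iff_deriv (n := 1)).1 hχ).2.2
  rw [pow_two, mul_assoc, mul_dilationAverage_deriv (hχ.of_le one_le_two) hχc hK' hK'', mul_neg,
    mul_dilationAverage_deriv hχ' hχc.deriv hK hK'c, neg_neg]

lemma integrable_dilationAverage_deriv_deriv {K K' K'' : ℝ → ℝ} (hχ : ContDiff ℝ 2 χ)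
    (hχc : HasCompactSupport χ) (hK : ∀ x, HasDerivAt K (K' x) x)
    (hK' : ∀ x, HasDerivAt K' (K'' x) x) (hK'' : Continuous K'') {C : ℝ} (hC : ∀ x, ‖K x‖ ≤ C)
    (hM : ∀ x, ‖K'' x‖ ≤ M) : Integrable (dilationAverage χ K'') := by
  have hχi : Integrable χ := hχ.continuous.integrable_of_hasCompactSupport hχc
  have hχ' : ContDiff ℝ 1 (deriv χ) := ((contDiff_succ_iff_deriv (n := 1)).1 hχ).2.2
  have hχ'' : Integrable (deriv (deriv χ)) :=
    (hχ'.continuous_deriv le_rfl).integrable_of_hasCompactSupport hχc.deriv.deriv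
  refine (integrable_inv_one_add_sq.const_mul
    ((∫ s, ‖χ s‖) * M + (∫ s, ‖deriv (deriv χ) s‖) * C)).mono'
    (continuous_dilationAverage hχi hK'' hM).aestronglyMeasurable (.of_forall fun t => ?_)
  have hbound := norm_dilationAverage_le hχi hM t
  have hdecay := norm_dilationAverage_le hχ'' hC t
  rw [← sq_mul_dilationAverage_deriv_deriv hχ hχc hK hK' hK'', norm_mul,
    Real.norm_of_nonneg (sq_nonneg t)] at hdecay
  rw [← div_eq_mul_inv, le_div_iff₀ (by positivity)]
  linarith

lemma exists_dilationAverage_ne_zero (hf : Continuous f) (hne : f ≠ 0) :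
    ∃ χ : ℝ → ℝ, ContDiff ℝ ∞ χ ∧ HasCompactSupport χ ∧ dilationAverage χ f ≠ 0 := by
  by_contra! hzero
  refine hne ((hf.ae_eq_iff_eq volume continuous_zero).1 ?_)
  exact ae_eq_zero_of_integral_contDiff_smul_eq_zero hf.locallyIntegrable fun χ hχ hχc => by
    simpa [dilationAverage] using congrFun (hzero χ hχ hχc) 1

lemma exists_integrable_dilationAverage_fwdDiff (hf : Continuous f) (hM : ∀ x, ‖f x‖ ≤ M)
    (hne : ∃ x y, f x ≠ f y) :
    ∃ h, ∃ χ : ℝ → ℝ, Integrable χ ∧ Continuous (dilationAverage χ (Δ_[h] (Δ_[h] f))) ∧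
      Integrable (dilationAverage χ (Δ_[h] (Δ_[h] f))) ∧
      dilationAverage χ (Δ_[h] (Δ_[h] f)) ≠ 0 := by
  obtain ⟨h, x, hx⟩ := exists_fwdDiff_fwdDiff_ne_zero hM hne
  obtain ⟨K, K', hK, hK', C, hC⟩ := exists_bounded_second_antiderivative_fwdDiff hf hM h
  have hcont : Continuous (Δ_[h] (Δ_[h] f)) := by unfold fwdDiff; fun_prop
  have hbound : ∀ x, ‖Δ_[h] (Δ_[h] f) x‖ ≤ M + M + (M + M) :=
    norm_fwdDiff_le_add (norm_fwdDiff_le_add hM h) h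
  obtain ⟨χ, hχ, hχc, hne⟩ := exists_dilationAverage_ne_zero hcont fun h0 => hx (congrFun h0 x)
  have hχi : Integrable χ := hχ.continuous.integrable_of_hasCompactSupport hχc
  exact ⟨h, χ, hχi, continuous_dilationAverage hχi hcont hbound,
    integrable_dilationAverage_deriv_deriv (contDiff_infty.1 hχ 2) hχc hK hK' hcont hC hbound,
    hne⟩

end DilationAverage

section Ridge

open scoped fwdDiff FourierTransform

variable {Z : Type*} [MeasurableSpace Z] {γ : Measure Z}

lemma exists_fourier_ne_zero {V F : Type*} [NormedAddCommGroup V] [InnerProductSpace ℝ V]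
    [MeasurableSpace V] [BorelSpace V] [FiniteDimensional ℝ V] [Nontrivial V]
    [NormedAddCommGroup F] [NormedSpace ℂ F] [CompleteSpace F] {S : V → F} (hSc : Continuous S)
    (hS : Integrable S) (hne : S ≠ 0) : ∃ w, w ≠ 0 ∧ 𝓕 S w ≠ 0 := by
  by_contra! hzero
  have hcont : Continuous (𝓕 S) :=
    VectorFourier.fourierIntegral_continuous Real.continuous_fourierChar
      (by exact continuous_inner) hS
  have hF : 𝓕 S = 0 := hcont.ext_on (dense_compl_singleton (0 : V)) continuous_const hzero
  apply hne
  rw [← hSc.fourierInv_fourier_eq hS (by rw [hF]; exact integrable_zero V F volume), hF]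
  ext v
  simp [Real.fourierInv_eq]

lemma integrable_mul_comp_add {G L : Type*} [AddGroup G] [MeasurableSpace G] [MeasurableAdd₂ G]
    {ν : Measure G} [SFinite ν] [ν.IsAddLeftInvariant] [NormedRing L] [SFinite γ] {g : Z → L}
    {S : G → L} {ℓ : Z → G} (hg : Integrable g γ) (hS : Integrable S ν) (hℓ : Measurable ℓ) :
    Integrable (fun y : Z × G => g y.1 * S (ℓ y.1 + y.2)) (γ.prod ν) :=
  ((MeasurePreserving.id γ).skew_product (g := fun z b => ℓ z + b)
    ((hℓ.comp measurable_fst).add measurable_snd)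
    (.of_forall fun z => map_add_left_eq_self ν (ℓ z))).integrable_comp_of_integrable
      (hg.mul_prod hS)

lemma fourier_comp_const_add {V F : Type*} [NormedAddCommGroup V] [InnerProductSpace ℝ V]
    [MeasurableSpace V] [BorelSpace V] [FiniteDimensional ℝ V] [NormedAddCommGroup F]
    [NormedSpace ℂ F] (S : V → F) (v w : V) :
    𝓕 (fun b => S (v + b)) w = Real.fourierChar (inner ℝ v w) • 𝓕 S w := by
  simp only [add_comm v]
  exact congrFun (VectorFourier.fourierIntegral_comp_add_right Real.fourierChar volume
    (innerₗ V) S v) w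

/-- The signed measure `g • γ` annihilates every ridge function `z ↦ f (s * ℓ z + b)` with profile
`f` and direction `ℓ`. -/
def Annihilates (γ : Measure Z) (g ℓ : Z → ℝ) (f : ℝ → ℝ) : Prop :=
  ∀ s b : ℝ, ∫ z, g z * f (s * ℓ z + b) ∂γ = 0

namespace Annihilates

variable {g ℓ : Z → ℝ} {f : ℝ → ℝ} {M : ℝ}

protected lemma fwdDiff (h : Annihilates γ g ℓ f) (hg : Integrable g γ) (hℓ : Measurable ℓ)
    (hf : Measurable f) (hM : ∀ x, ‖f x‖ ≤ M) (v : ℝ) : Annihilates γ g ℓ (Δ_[v] f) := by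
  intro s b
  have hint : ∀ b, Integrable (fun z => g z * f (s * ℓ z + b)) γ := fun b =>
    hg.mul_bdd (hf.comp ((hℓ.const_mul s).add_const b)).aestronglyMeasurable
      (.of_forall fun z => hM _)
  simp only [fwdDiff, mul_sub, add_assoc]
  rw [integral_sub (hint _) (hint _), h, h, sub_zero]

protected lemma dilationAverage [SFinite γ] (h : Annihilates γ g ℓ f) (hg : Integrable g γ)
    (hℓ : Measurable ℓ) (hf : Measurable f) (hM : ∀ x, ‖f x‖ ≤ M) {χ : ℝ → ℝ}
    (hχ : Integrable χ) : Annihilates γ g ℓ (dilationAverage χ f) := by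
  intro s b
  have hint : Integrable (fun y : Z × ℝ => g y.1 * χ y.2 * f (y.2 * (s * ℓ y.1 + b)))
      (γ.prod volume) :=
    (hg.mul_prod hχ).mul_bdd (hf.comp (by fun_prop)).aestronglyMeasurable (.of_forall fun y => hM _)
  have hslice : ∀ u, ∫ z, g z * χ u * f (u * (s * ℓ z + b)) ∂γ = 0 := by
    intro u
    calc ∫ z, g z * χ u * f (u * (s * ℓ z + b)) ∂γ
        = ∫ z, χ u * (g z * f (u * s * ℓ z + u * b)) ∂γ := by
          congr 1 with z
          rw [mul_add, mul_assoc u s]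
          ring
      _ = 0 := by rw [integral_const_mul, h, mul_zero]
  calc ∫ z, g z * dilationAverage χ f (s * ℓ z + b) ∂γ
      = ∫ z, (∫ u, g z * χ u * f (u * (s * ℓ z + b))) ∂γ := by
        simp only [dilationAverage, mul_assoc, integral_const_mul]
    _ = ∫ u, (∫ z, g z * χ u * f (u * (s * ℓ z + b)) ∂γ) := integral_integral_swap hint
    _ = 0 := by simp only [hslice, integral_zero]

/-- Take the Fourier transform in `b` of `∫ z, g z * f (s * ℓ z + b) ∂γ = 0`, at a frequency `w`
where that of `f` does not vanish; the slope `s = 1 / (2πw)` produces the phase `e^{iℓ}`. -/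
lemma integral_exp_eq_zero_of_integrable [SFinite γ] (h : Annihilates γ g ℓ f)
    (hg : Integrable g γ) (hℓ : Measurable ℓ) (hfc : Continuous f) (hf : Integrable f)
    (hne : f ≠ 0) : ∫ z, (g z : ℂ) * Complex.exp (ℓ z * Complex.I) ∂γ = 0 := by
  set S : ℝ → ℂ := fun t => f t
  obtain ⟨w, hw, hSw⟩ : ∃ w, w ≠ 0 ∧ 𝓕 S w ≠ 0 :=
    exists_fourier_ne_zero (by fun_prop) hf.ofReal fun h0 =>
      hne (funext fun t => Complex.ofReal_eq_zero.1 (congrFun h0 t))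
  set s : ℝ := (2 * Real.pi * w)⁻¹
  have hint : Integrable (fun y : Z × ℝ =>
      (Real.fourierChar (-(y.2 * w)) : ℂ) * ((g y.1 : ℂ) * S (s * ℓ y.1 + y.2)))
      (γ.prod volume) :=
    (integrable_mul_comp_add hg.ofReal hf.ofReal (hℓ.const_mul s)).bdd_mul (c := 1)
      (by fun_prop) (.of_forall fun y => (Circle.norm_coe _).le)
  have hinner : ∀ z, ∫ b, (Real.fourierChar (-(b * w)) : ℂ) * ((g z : ℂ) * S (s * ℓ z + b)) =
      g z * Complex.exp (ℓ z * Complex.I) * 𝓕 S w := by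
    intro z
    have hphase : 2 * Real.pi * inner ℝ (s * ℓ z) w = ℓ z := by
      simp only [s, Real.inner_apply]
      field_simp
    have hshift := fourier_comp_const_add S (s * ℓ z) w
    rw [Real.fourier_real_eq, Circle.smul_def, Real.fourierChar_apply, hphase] at hshift
    simp only [mul_left_comm _ (g z : ℂ), integral_const_mul]
    rw [mul_assoc, ← smul_eq_mul (Complex.exp _), ← hshift]
    rfl
  have hslice : ∀ b, ∫ z, (Real.fourierChar (-(b * w)) : ℂ) * ((g z : ℂ) * S (s * ℓ z + b)) ∂γ =
      0 := by
    intro b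
    have hreal := h s b
    rw [integral_const_mul]
    simp only [S, ← Complex.ofReal_mul, integral_complex_ofReal, hreal, Complex.ofReal_zero,
      mul_zero]
  refine (mul_eq_zero.1 ?_).resolve_right hSw
  rw [← integral_mul_const]
  simp only [← hinner]
  rw [integral_integral_swap hint]
  simp only [hslice, integral_zero]

lemma integral_exp_eq_zero [SFinite γ] (h : Annihilates γ g ℓ f) (hg : Integrable g γ)
    (hℓ : Measurable ℓ) (hf : Continuous f) (hM : ∀ x, ‖f x‖ ≤ M) (hne : ∃ x y, f x ≠ f y) :
    ∫ z, (g z : ℂ) * Complex.exp (ℓ z * Complex.I) ∂γ = 0 := by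
  obtain ⟨v, χ, hχ, hcont, hint, hprofile⟩ := exists_integrable_dilationAverage_fwdDiff hf hM hne
  have hdiff : Continuous (Δ_[v] f) := by unfold fwdDiff; fun_prop
  have hdiff₂ : Continuous (Δ_[v] (Δ_[v] f)) := by unfold fwdDiff; fun_prop
  have h₁ := h.fwdDiff hg hℓ hf.measurable hM v
  have h₂ := h₁.fwdDiff hg hℓ hdiff.measurable (norm_fwdDiff_le_add hM v) v
  have h₃ := h₂.dilationAverage hg hℓ hdiff₂.measurable
    (norm_fwdDiff_le_add (norm_fwdDiff_le_add hM v) v) hχ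
  exact h₃.integral_exp_eq_zero_of_integrable hg hℓ hcont hint hprofile

end Annihilates

end Ridge

section Duality

open Filter Topology

lemma dense_of_forall_dual {𝕜 E : Type*} [RCLike 𝕜] [NormedAddCommGroup E] [NormedSpace 𝕜 E]
    (V : Submodule 𝕜 E) (h : ∀ F : StrongDual 𝕜 E, (∀ v ∈ V, F v = 0) → F = 0) :
    Dense (V : Set E) := by
  rw [Submodule.dense_iff_topologicalClosure_eq_top, Submodule.eq_top_iff']
  intro x
  have : IsClosed (V.topologicalClosure : Set E) := V.isClosed_topologicalClosure
  rw [← Submodule.Quotient.mk_eq_zero]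
  refine SeparatingDual.eq_zero_of_forall_dual_eq_zero (R := 𝕜) fun f => ?_
  have hF := h (f.comp V.topologicalClosure.mkQL) fun v hv => by
    simp [(Submodule.Quotient.mk_eq_zero _).2 (V.le_topologicalClosure hv)]
  exact DFunLike.congr_fun hF x

variable {Z : Type*} [MeasurableSpace Z] {γ : Measure Z} {r : ℝ≥0∞}

lemma indicatorConstLp_eq_smul_one {s : Set Z} (hs : MeasurableSet s) (hγs : γ s ≠ ∞) (c : ℝ) :
    indicatorConstLp r hs hγs c = c • indicatorConstLp r hs hγs 1 := by
  rw [indicatorConstLp, indicatorConstLp, ← MemLp.toLp_const_smul]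
  congr 1
  ext z
  by_cases hz : z ∈ s <;> simp [hz]

variable [IsFiniteMeasure γ] [Fact (1 ≤ r)]

lemma hasSum_indicatorConstLp {E : Type*} [NormedAddCommGroup E] (hr : r ≠ ∞) {s : ℕ → Set Z}
    (hs : ∀ i, MeasurableSet (s i)) (hd : Pairwise (Function.onFun Disjoint s)) (c : E) :
    HasSum (fun i => indicatorConstLp r (hs i) (measure_ne_top γ (s i)) c)
      (indicatorConstLp r (MeasurableSet.iUnion hs) (measure_ne_top γ _) c) := by
  have hfinite : ∀ b : Finset ℕ, MeasurableSet (⋃ i ∈ b, s i) := fun b =>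
    b.measurableSet_biUnion fun i _ => hs i
  have hpartial : ∀ b : Finset ℕ, ∑ i ∈ b, indicatorConstLp r (hs i) (measure_ne_top γ (s i)) c =
      indicatorConstLp r (hfinite b) (measure_ne_top γ _) c := by
    intro b
    induction b using Finset.induction_on with
    | empty => simp
    | insert a b ha ih =>
      rw [Finset.sum_insert ha, ih, ← indicatorConstLp_disjoint_union]
      · simp
      · exact Set.disjoint_iUnion₂_right.2 fun i hi => hd (ne_of_mem_of_not_mem hi ha).symm
  have hremainder : ∀ b : Finset ℕ,
      γ (symmDiff (⋃ i ∈ b, s i) (⋃ i, s i)) ≤ ∑' i : {i // i ∉ b}, γ (s i) := by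
    refine fun b => (measure_mono ?_).trans (measure_iUnion_le _)
    intro z hz
    simp only [Set.mem_symmDiff, Set.mem_iUnion, Subtype.exists] at hz ⊢
    rcases hz with ⟨⟨i, _, hi⟩, hn⟩ | ⟨⟨i, hi⟩, hn⟩
    · exact absurd ⟨i, hi⟩ hn
    · exact ⟨i, fun hib => hn ⟨i, hib, hi⟩, hi⟩
  have hsum : ∑' i, γ (s i) ≠ ∞ := by
    rw [← measure_iUnion hd hs]
    exact measure_ne_top γ _
  simp only [HasSum, hpartial, SummationFilter.unconditional_filter]
  exact tendsto_indicatorConstLp_set hr <| tendsto_of_tendsto_of_tendsto_of_le_of_le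
    tendsto_const_nhds (ENNReal.tendsto_tsum_compl_atTop_zero hsum) (fun _ => zero_le) hremainder

open Classical in
/-- The `L^r`-valued vector measure `s ↦ 𝟙_s`. -/
def indicatorVectorMeasure (γ : Measure Z) [IsFiniteMeasure γ] (hr : r ≠ ∞) :
    VectorMeasure Z (Lp ℝ r γ) where
  measureOf' s := if hs : MeasurableSet s then
    indicatorConstLp r hs (measure_ne_top γ s) 1 else 0
  empty' := by simp
  not_measurable' s hs := dif_neg hs
  m_iUnion' s hs hd := by
    simpa only [hs, MeasurableSet.iUnion hs, dif_pos] using hasSum_indicatorConstLp hr hs hd 1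

lemma indicatorVectorMeasure_apply (hr : r ≠ ∞) {s : Set Z} (hs : MeasurableSet s) :
    indicatorVectorMeasure γ hr s = indicatorConstLp r hs (measure_ne_top γ s) 1 :=
  dif_pos hs

lemma exists_setIntegral_eq_dual_indicator (hr : r ≠ ∞) (F : StrongDual ℝ (Lp ℝ r γ)) :
    ∃ g : Z → ℝ, Integrable g γ ∧ ∀ s (hs : MeasurableSet s),
      F (indicatorConstLp r hs (measure_ne_top γ s) 1) = ∫ z in s, g z ∂γ := by
  set ν : SignedMeasure Z :=
    (indicatorVectorMeasure γ hr).mapRange (F : Lp ℝ r γ →+ ℝ) F.continuous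
  have hν : ∀ s (hs : MeasurableSet s),
      ν s = F (indicatorConstLp r hs (measure_ne_top γ s) 1) := fun s hs =>
    congrArg F (indicatorVectorMeasure_apply hr hs)
  have hac : ν ≪ᵥ γ.toENNRealVectorMeasure := by
    refine VectorMeasure.AbsolutelyContinuous.mk fun s hs h0 => ?_
    rw [Measure.toENNRealVectorMeasure_apply_measurable hs] at h0
    have hzero : indicatorConstLp r hs (measure_ne_top γ s) (1 : ℝ) = 0 := by
      rw [Lp.eq_zero_iff_ae_eq_zero]
      exact indicatorConstLp_coeFn.trans (indicator_meas_zero h0)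
    rw [hν s hs, hzero, map_zero]
  refine ⟨ν.rnDeriv γ, SignedMeasure.integrable_rnDeriv _ _, fun s hs => ?_⟩
  rw [← hν s hs, ← withDensityᵥ_apply (SignedMeasure.integrable_rnDeriv _ _) hs,
    SignedMeasure.withDensityᵥ_rnDeriv_eq ν γ hac]

variable {F : StrongDual ℝ (Lp ℝ r γ)} {g : Z → ℝ}

lemma dual_toLp_simpleFunc (hg : Integrable g γ)
    (hF : ∀ s (hs : MeasurableSet s),
      F (indicatorConstLp r hs (measure_ne_top γ s) 1) = ∫ z in s, g z ∂γ) (f : SimpleFunc Z ℝ) :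
    F ((f.memLp_of_isFiniteMeasure r γ).toLp f) = ∫ z, g z * f z ∂γ := by
  have hint : ∀ f : SimpleFunc Z ℝ, Integrable (fun z => g z * f z) γ := fun f =>
    let ⟨_, hC⟩ := f.exists_forall_norm_le
    hg.mul_bdd f.measurable.aestronglyMeasurable (.of_forall hC)
  induction f using SimpleFunc.induction with
  | @const c s hs =>
    have hindicator : MemLp.toLp _ ((SimpleFunc.piecewise s hs (.const _ c) (.const _ 0)
        ).memLp_of_isFiniteMeasure r γ) = c • indicatorConstLp r hs (measure_ne_top γ s) 1 := by
      rw [← indicatorConstLp_eq_smul_one, indicatorConstLp]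
      congr 1
    rw [hindicator, map_smul, hF s hs, smul_eq_mul, ← integral_const_mul, ← integral_indicator hs]
    congr 1 with z
    by_cases hz : z ∈ s <;> simp [hz, mul_comm]
  | @add f₁ f₂ _ hf₁ hf₂ =>
    have hadd : MemLp.toLp _ ((f₁ + f₂).memLp_of_isFiniteMeasure r γ) =
        MemLp.toLp f₁ (f₁.memLp_of_isFiniteMeasure r γ) +
          MemLp.toLp f₂ (f₂.memLp_of_isFiniteMeasure r γ) := rfl
    rw [hadd, map_add, hf₁, hf₂, ← integral_add (hint f₁) (hint f₂)]
    simp only [SimpleFunc.add_apply, mul_add]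

lemma dual_toLp_eq_integral (hr : r ≠ ∞) (hg : Integrable g γ)
    (hF : ∀ s (hs : MeasurableSet s),
      F (indicatorConstLp r hs (measure_ne_top γ s) 1) = ∫ z in s, g z ∂γ)
    {f : Z → ℝ} (hf : MemLp f r γ) (hfm : Measurable f) (hgf : Integrable (fun z => g z * f z) γ) :
    F (hf.toLp f) = ∫ z, g z * f z ∂γ := by
  set a : ℕ → SimpleFunc Z ℝ := SimpleFunc.approxOn f hfm (Set.range f ∪ {0}) 0 (by simp)
  have hLp : Tendsto (fun n => F (((a n).memLp_of_isFiniteMeasure r γ).toLp (a n))) atTop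
      (𝓝 (F (hf.toLp f))) :=
    (F.continuous.tendsto _).comp (SimpleFunc.tendsto_approxOn_range_Lp hr hfm hf)
  have hintegral : Tendsto (fun n => ∫ z, g z * a n z ∂γ) atTop (𝓝 (∫ z, g z * f z ∂γ)) := by
    refine tendsto_integral_of_dominated_convergence (fun z => ‖g z * f z‖ + ‖g z * f z‖)
      (fun n => hg.1.mul (a n).measurable.aestronglyMeasurable) (hgf.norm.add hgf.norm)
      (fun n => .of_forall fun z => ?_) (.of_forall fun z => ?_)
    · rw [norm_mul, norm_mul, ← mul_add]
      exact mul_le_mul_of_nonneg_left (SimpleFunc.norm_approxOn_zero_le hfm _ z n) (norm_nonneg _)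
    · exact (SimpleFunc.tendsto_approxOn hfm _ (subset_closure (by simp))).const_mul _
  simp only [dual_toLp_simpleFunc hg hF] at hLp
  exact tendsto_nhds_unique hLp hintegral

lemma dual_eq_zero_of_indicator (hr : r ≠ ∞)
    (hF : ∀ s (hs : MeasurableSet s), F (indicatorConstLp r hs (measure_ne_top γ s) 1) = 0) :
    F = 0 := by
  ext f
  induction f using Lp.induction hr with
  | @indicatorConst c s hs hγs =>
    rw [Lp.simpleFunc.coe_indicatorConst, indicatorConstLp_eq_smul_one, map_smul, hF, smul_zero,
      zero_apply]
  | add hf₁ hf₂ _ h₁ h₂ => rw [map_add, h₁, h₂, map_add]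
  | isClosed => exact isClosed_eq F.continuous continuous_const

/-- The classes in `L^r` of the `r`-integrable elements of a space `W` of functions. -/
def lpOfSubmodule (W : Submodule ℝ (Z → ℝ)) (γ : Measure Z) (r : ℝ≥0∞) :
    Submodule ℝ (Lp ℝ r γ) where
  carrier := {f | ∃ H ∈ W, ∃ hH : MemLp H r γ, hH.toLp H = f}
  add_mem' := by
    rintro _ _ ⟨H₁, h₁, hH₁, rfl⟩ ⟨H₂, h₂, hH₂, rfl⟩
    exact ⟨H₁ + H₂, W.add_mem h₁ h₂, hH₁.add hH₂, MemLp.toLp_add hH₁ hH₂⟩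
  zero_mem' := ⟨0, W.zero_mem, MemLp.zero, MemLp.toLp_zero _⟩
  smul_mem' := by
    rintro c _ ⟨H, h, hH, rfl⟩
    exact ⟨c • H, W.smul_mem c h, hH.const_smul c, MemLp.toLp_const_smul c hH⟩

lemma dense_lpOfSubmodule (hr : r ≠ ∞) {W : Submodule ℝ (Z → ℝ)}
    (h : ∀ g : Z → ℝ, Integrable g γ →
      (∀ f ∈ W, Measurable f → ∀ M : ℝ, (∀ z, ‖f z‖ ≤ M) → ∫ z, g z * f z ∂γ = 0) → g =ᵐ[γ] 0) :
    Dense (lpOfSubmodule W γ r : Set (Lp ℝ r γ)) := by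
  refine dense_of_forall_dual _ fun F hF => ?_
  obtain ⟨g, hg, hFg⟩ := exists_setIntegral_eq_dual_indicator hr F
  have hg0 : g =ᵐ[γ] 0 := h g hg fun f hfW hfm M hM => by
    have hfLp : MemLp f r γ := .of_bound hfm.aestronglyMeasurable M (.of_forall hM)
    rw [← dual_toLp_eq_integral hr hg hFg hfLp hfm
      (hg.mul_bdd hfm.aestronglyMeasurable (.of_forall hM))]
    exact hF _ ⟨f, hfW, hfLp, rfl⟩
  refine dual_eq_zero_of_indicator hr fun s hs => ?_
  rw [hFg s hs, integral_eq_zero_of_ae (ae_restrict_of_ae hg0)]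

end Duality

section Uniqueness

open Filter

lemma integral_withDensity_ofReal_sub {Z F : Type*} [MeasurableSpace Z] {γ : Measure Z}
    [NormedAddCommGroup F] [NormedSpace ℝ F] {g : Z → ℝ} (hg : Integrable g γ) {f : Z → F}
    (hf : AEStronglyMeasurable f γ) {M : ℝ} (hM : ∀ z, ‖f z‖ ≤ M) :
    ∫ z, f z ∂(γ.withDensity fun z => .ofReal (g z)) -
      ∫ z, f z ∂(γ.withDensity fun z => .ofReal (-g z)) = ∫ z, g z • f z ∂γ := by
  have hint : ∀ k : Z → ℝ, Integrable k γ →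
      Integrable (fun z => (ENNReal.ofReal (k z)).toReal • f z) γ := fun k hk => by
    simp only [ENNReal.toReal_ofReal']
    exact hk.pos_part.smul_bdd _ hf (.of_forall hM)
  have hneg : AEMeasurable (fun z => ENNReal.ofReal (-g z)) γ :=
    hg.neg.1.aemeasurable.ennreal_ofReal
  rw [integral_withDensity_eq_integral_toReal_smul₀ hg.1.aemeasurable.ennreal_ofReal (by simp),
    integral_withDensity_eq_integral_toReal_smul₀ hneg (by simp),
    ← integral_sub (hint g hg) (hint (fun z => -g z) hg.neg)]
  simp only [← sub_smul, ENNReal.toReal_ofReal', max_zero_sub_max_neg_zero_eq_self]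

variable {Z E : Type*} [AddCommGroup E] [Module ℝ E] {Φ : E →ₗ[ℝ] Z → ℝ}

lemma measure_ext_of_integral_exp [mZ : MeasurableSpace Z]
    (hΦ : mZ = MeasurableSpace.comap (fun z v => Φ v z) MeasurableSpace.pi) {μ ν : Measure Z}
    [IsFiniteMeasure μ] [IsFiniteMeasure ν]
    (h : ∀ v, ∫ z, Complex.exp (Φ v z * Complex.I) ∂μ = ∫ z, Complex.exp (Φ v z * Complex.I) ∂ν) :
    μ = ν := by
  set T : Z → E → ℝ := fun z v => Φ v z
  have hT : Measurable T := measurable_iff_comap_le.2 hΦ.ge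
  have hmarginal : ∀ J : Finset E, (μ.map T).map J.restrict = (ν.map T).map J.restrict := by
    classical
    intro J
    have hJ : Measurable (J.restrict ∘ T) := J.measurable_restrict.comp hT
    have hcombination : ∀ (L : StrongDual ℝ (J → ℝ)) (z : Z),
        L (J.restrict (T z)) = Φ (∑ v : J, L (fun u => if v = u then 1 else 0) • (v : E)) z := by
      intro L z
      rw [map_sum, Finset.sum_apply, ← L.coe_coe, L.toLinearMap.pi_apply_eq_sum_univ]
      exact Finset.sum_congr rfl fun v _ => by simp [mul_comm, T]
    rw [Measure.map_map J.measurable_restrict hT, Measure.map_map J.measurable_restrict hT]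
    refine Measure.ext_of_charFunDual (funext fun L => ?_)
    rw [charFunDual_apply, charFunDual_apply,
      integral_map hJ.aemeasurable (by fun_prop), integral_map hJ.aemeasurable (by fun_prop)]
    simpa only [Function.comp_apply, hcombination] using h _
  have hmap : μ.map T = ν.map T :=
    IsProjectiveLimit.unique (P := fun J => (ν.map T).map J.restrict) hmarginal fun _ => rfl
  ext s hs
  obtain ⟨t, ht, rfl⟩ := hΦ.le s hs
  rw [← Measure.map_apply hT ht, hmap, Measure.map_apply hT ht]

lemma ae_eq_zero_of_integral_mul_exp_eq_zero [mZ : MeasurableSpace Z]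
    (hΦ : mZ = MeasurableSpace.comap (fun z v => Φ v z) MeasurableSpace.pi) {γ : Measure Z}
    {g : Z → ℝ} (hg : Integrable g γ)
    (h : ∀ v, ∫ z, (g z : ℂ) * Complex.exp (Φ v z * Complex.I) ∂γ = 0) : g =ᵐ[γ] 0 := by
  have := isFiniteMeasure_withDensity_ofReal hg.2
  have := isFiniteMeasure_withDensity_ofReal hg.neg.2
  have hT : Measurable fun z v => Φ v z := measurable_iff_comap_le.2 hΦ.ge
  have heq : γ.withDensity (fun z => .ofReal (g z)) = γ.withDensity fun z => .ofReal (-g z) := by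
    refine measure_ext_of_integral_exp hΦ fun v => sub_eq_zero.1 ?_
    have hv : Measurable fun z => Φ v z := measurable_pi_iff.1 hT v
    rw [integral_withDensity_ofReal_sub hg (by fun_prop)
      fun z => (Complex.norm_exp_ofReal_mul_I _).le, ← h v]
    simp only [Complex.real_smul]
  have hae := (withDensity_eq_iff hg.1.aemeasurable.ennreal_ofReal
    hg.1.aemeasurable.neg.ennreal_ofReal hg.lintegral_lt_top.ne).1 heq
  filter_upwards [hae] with z hz
  have := congrArg ENNReal.toReal hz
  simp only [ENNReal.toReal_ofReal', Pi.neg_apply] at this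
  rw [← max_zero_sub_max_neg_zero_eq_self (g z), this, sub_self, Pi.zero_apply]

end Uniqueness

section RidgeSpan

variable {Z E : Type*} [AddCommGroup E] [Module ℝ E]

/-- The linear span of the affine rescalings `x ↦ σ (α x + β)` of an activation function `σ`. -/
def rescalingSpan (σ : ℝ → ℝ) : Submodule ℝ (ℝ → ℝ) :=
  .span ℝ (Set.range fun (θ : ℝ × ℝ) x => σ (θ.1 * x + θ.2))

/-- The shallow networks `z ↦ ∑ᵢ wᵢ σ (Φ vᵢ z + bᵢ)` on a linear family `Φ` of features of `z`. -/
def ridgeSpan (Φ : E →ₗ[ℝ] Z → ℝ) (σ : ℝ → ℝ) : Submodule ℝ (Z → ℝ) :=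
  .span ℝ (Set.range fun (θ : E × ℝ) z => σ (Φ θ.1 z + θ.2))

lemma mem_rescalingSpan_self (σ : ℝ → ℝ) : σ ∈ rescalingSpan σ :=
  Submodule.subset_span ⟨(1, 0), by simp⟩

lemma comp_mem_ridgeSpan (Φ : E →ₗ[ℝ] Z → ℝ) {σ τ : ℝ → ℝ} (hτ : τ ∈ rescalingSpan σ) (v : E)
    (b : ℝ) : (fun z => τ (Φ v z + b)) ∈ ridgeSpan Φ σ := by
  refine (Submodule.map_span_le (LinearMap.funLeft ℝ ℝ fun z => Φ v z + b) _ _).2 ?_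
    (Submodule.mem_map_of_mem hτ)
  rintro _ ⟨⟨α, β⟩, rfl⟩
  refine Submodule.subset_span ⟨(α • v, α * b + β), funext fun z => ?_⟩
  simp [LinearMap.funLeft_apply, mul_add, add_assoc]

lemma dense_lpOfSubmodule_ridgeSpan [mZ : MeasurableSpace Z] {Φ : E →ₗ[ℝ] Z → ℝ}
    (hΦ : mZ = MeasurableSpace.comap (fun z v => Φ v z) MeasurableSpace.pi) {γ : Measure Z}
    [IsFiniteMeasure γ] {r : ℝ≥0∞} [Fact (1 ≤ r)] (hr : r ≠ ∞) {σ τ : ℝ → ℝ}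
    (hτ : τ ∈ rescalingSpan σ) (hcont : Continuous τ) {M : ℝ} (hM : ∀ x, ‖τ x‖ ≤ M)
    (hne : ∃ x y, τ x ≠ τ y) : Dense (lpOfSubmodule (ridgeSpan Φ σ) γ r : Set (Lp ℝ r γ)) := by
  refine dense_lpOfSubmodule hr fun g hg hann => ae_eq_zero_of_integral_mul_exp_eq_zero hΦ hg
    fun v => ?_
  have hv : Measurable (Φ v) :=
    measurable_pi_iff.1 (measurable_iff_comap_le.2 hΦ.ge : Measurable fun z v => Φ v z) v
  have hridge : Annihilates γ g (Φ v) τ := fun s b => by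
    refine hann (fun z => τ (s * Φ v z + b)) ?_ (by fun_prop) M fun z => hM _
    simpa only [map_smul, Pi.smul_apply, smul_eq_mul] using
      comp_mem_ridgeSpan Φ hτ (s • v) b
  exact hridge.integral_exp_eq_zero hg hv hcont hM hne

end RidgeSpan

section DelayLine

lemma memℓp_extend {α β F : Type*} [NormedAddCommGroup F] {s : α → β} (hs : s.Injective)
    {q : ℝ≥0∞} {x : α → F} (hx : Memℓp x q) : Memℓp (Function.extend s x 0) q := by
  have hzero : ∀ j ∉ Set.range s, Function.extend s x 0 j = 0 := fun j hj =>
    Function.extend_apply' _ _ _ hj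
  rcases q.trichotomy with rfl | rfl | hq
  · refine memℓp_zero ((hx.finite_dsupport.image s).subset fun j hj => ?_)
    obtain ⟨i, rfl⟩ := not_imp_comm.1 (hzero j) hj
    exact ⟨i, by simpa only [Set.mem_ofPred_eq, hs.extend_apply] using hj, rfl⟩
  · obtain ⟨M, hM⟩ := hx.bddAbove
    refine memℓp_infty ⟨max M 0, ?_⟩
    rintro _ ⟨j, rfl⟩
    by_cases hj : j ∈ Set.range s
    · obtain ⟨i, rfl⟩ := hj
      exact le_max_of_le_left (by simpa only [hs.extend_apply] using hM ⟨i, rfl⟩)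
    · simp [hzero j hj]
  · refine memℓp_gen ((hs.summable_iff fun j hj => ?_).1 ?_)
    · rw [hzero j hj, norm_zero, Real.zero_rpow hq.ne']
    · simpa only [Function.comp_def, hs.extend_apply] using hx.summable hq

lemma memℓp_geometric {r : ℝ} (hr : ‖r‖ < 1) {q : ℝ≥0∞} (hq : q ≠ 0) :
    Memℓp (fun i : ℕ => r ^ i) q := by
  rcases q.trichotomy with rfl | rfl | hq'
  · exact absurd rfl hq
  · refine memℓp_infty ⟨1, ?_⟩
    rintro _ ⟨i, rfl⟩
    simp only [norm_pow]
    exact pow_le_one₀ (norm_nonneg _) hr.le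
  · refine memℓp_gen ?_
    simp only [norm_pow, ← Real.rpow_natCast_mul (norm_nonneg r), mul_comm _ q.toReal,
      Real.rpow_mul_natCast (norm_nonneg r)]
    exact summable_geometric_of_lt_one (by positivity) (Real.rpow_lt_one (norm_nonneg _) hr hq')

variable {d : ℕ} {q : ℝ≥0∞}

/-- The time `t - k`. -/
def ZMinus.back (t : ZMinus) (k : ℕ) : ZMinus := ⟨t.1 - k, by have := t.2; omega⟩

lemma ZMinus.back_zero (t : ZMinus) : t.back 0 = t := Subtype.ext (by simp [ZMinus.back])

lemma ZMinus.back_succ (t : ZMinus) (k : ℕ) : t.back (k + 1) = t.pred.back k :=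
  Subtype.ext (by simp only [ZMinus.back, ZMinus.pred]; omega)

/-- The coordinates of `v ∈ ℝ^d`, followed by zeros. -/
def padded (v : EuclideanSpace ℝ (Fin d)) : ℕ → ℝ := Function.extend Fin.val v 0

lemma padded_val (v : EuclideanSpace ℝ (Fin d)) (j : Fin d) : padded v j = v j :=
  Fin.val_injective.extend_apply _ _ _

lemma padded_of_le (v : EuclideanSpace ℝ (Fin d)) {j : ℕ} (hj : d ≤ j) : padded v j = 0 :=
  Function.extend_apply' _ _ _ fun ⟨i, hi⟩ => (hi ▸ i.2).not_ge hj

lemma padded_add (v v' : EuclideanSpace ℝ (Fin d)) : padded (v + v') = padded v + padded v' :=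
  map_add (Function.ExtendByZero.linearMap ℝ Fin.val) ⇑v ⇑v'

lemma padded_smul (c : ℝ) (v : EuclideanSpace ℝ (Fin d)) : padded (c • v) = c • padded v :=
  map_smul (Function.ExtendByZero.linearMap ℝ Fin.val) c ⇑v

lemma norm_padded_le (v : EuclideanSpace ℝ (Fin d)) (j : ℕ) : ‖padded v j‖ ≤ ‖v‖ := by
  rcases lt_or_ge j d with hj | hj
  · exact (padded_val v ⟨j, hj⟩).symm ▸ PiLp.norm_apply_le v _
  · simp [padded_of_le v hj]

/-- The state at time `t` of a delay line storing the whole past of `z`. It consists of blocks of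
length `d + 1` (positive also for `d = 0`), the `k`-th of which holds `z_{t-k}` and a zero; the
weights `2⁻ⁱ` put bounded inputs into every `ℓ^q` with `q ≠ 0`. -/
def delayLine (z : InputSeq d) (t : ZMinus) (i : ℕ) : ℝ :=
  (1 / 2) ^ i * padded (z (t.back (i / (d + 1)))) (i % (d + 1))

lemma norm_half_pow_mul_le {y M : ℝ} (hM : ‖y‖ ≤ M) (i : ℕ) :
    ‖(1 / 2) ^ i * y‖ ≤ M * (1 / 2) ^ i := by
  rw [norm_mul, norm_pow, norm_div, norm_one, Real.norm_two, mul_comm]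
  gcongr

lemma memℓp_half_pow_mul (hq : q ≠ 0) {x : ℕ → ℝ} {M : ℝ} (hM : ∀ i, ‖x i‖ ≤ M) :
    Memℓp (fun i => (1 / 2) ^ i * x i) q :=
  ((memℓp_geometric (r := 1 / 2) (by norm_num) hq).const_mul M).mono fun i =>
    norm_half_pow_mul_le (hM i) i

/-- The transition operator of the delay line, which moves each block into the next one. -/
def delayShift (d : ℕ) (q : ℝ≥0∞) : SeqSpace q →ₗ[ℝ] SeqSpace q where
  toFun x := (1 / 2 : ℝ) ^ (d + 1) •
    ⟨Function.extend (· + (d + 1)) x 0, memℓp_extend (add_left_injective _) (lp.memℓp x)⟩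
  map_add' x y := by
    rw [← smul_add]
    congr 1
    exact lp.ext (map_add (Function.ExtendByZero.linearMap ℝ (· + (d + 1))) ⇑x ⇑y)
  map_smul' c x := by
    rw [RingHom.id_apply, smul_comm]
    congr 1
    exact lp.ext (map_smul (Function.ExtendByZero.linearMap ℝ (· + (d + 1))) c ⇑x)

lemma delayShift_apply_of_lt (x : SeqSpace q) {i : ℕ} (hi : i < d + 1) :
    delayShift d q x i = 0 := by
  refine mul_eq_zero_of_right _ (Function.extend_apply' _ _ _ ?_)
  rintro ⟨j, rfl⟩
  omega

lemma delayShift_apply_add (x : SeqSpace q) (i : ℕ) :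
    delayShift d q x (i + (d + 1)) = (1 / 2) ^ (d + 1) * x i :=
  congrArg _ ((add_left_injective (d + 1)).extend_apply _ _ i)

/-- The input operator of the delay line, which writes the current input into the first block. -/
def delayInput (d : ℕ) (hq : q ≠ 0) : EuclideanSpace ℝ (Fin d) →ₗ[ℝ] SeqSpace q where
  toFun v := ⟨fun i => (1 / 2) ^ i * padded v i, memℓp_half_pow_mul hq (norm_padded_le v)⟩
  map_add' v v' := lp.ext <| funext fun i => by
    simp only [padded_add, lp.coeFn_add, Pi.add_apply, mul_add]
  map_smul' c v := lp.ext <| funext fun i => by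
    simp only [padded_smul, lp.coeFn_smul, Pi.smul_apply, smul_eq_mul, RingHom.id_apply,
      mul_left_comm]

lemma delayInput_apply (hq : q ≠ 0) (v : EuclideanSpace ℝ (Fin d)) (i : ℕ) :
    delayInput d hq v i = (1 / 2) ^ i * padded v i := rfl

lemma delayLine_of_lt (z : InputSeq d) (t : ZMinus) {i : ℕ} (hi : i < d + 1) :
    delayLine z t i = (1 / 2) ^ i * padded (z t) i := by
  rw [delayLine, Nat.div_eq_of_lt hi, Nat.mod_eq_of_lt hi, ZMinus.back_zero]

lemma delayLine_add (z : InputSeq d) (t : ZMinus) (i : ℕ) :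
    delayLine z t (i + (d + 1)) = (1 / 2) ^ (d + 1) * delayLine z t.pred i := by
  rw [delayLine, delayLine, Nat.add_div_right _ d.succ_pos, Nat.add_mod_right, ZMinus.back_succ,
    pow_add]
  ring

lemma delay_recursion_iff (hq : q ≠ 0) {z : InputSeq d} {x : ZMinus → SeqSpace q} :
    (∀ t i, x t i = (delayShift d q (x t.pred) + delayInput d hq (z t)) i) ↔
      ∀ t i, x t i = delayLine z t i := by
  have hfirst : ∀ t i, i < d + 1 →
      (delayShift d q (x t.pred) + delayInput d hq (z t)) i = delayLine z t i := fun t i hi => by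
    rw [lp.coeFn_add, Pi.add_apply, delayShift_apply_of_lt _ hi, zero_add, delayInput_apply,
      delayLine_of_lt z t hi]
  have hnext : ∀ t i, (delayShift d q (x t.pred) + delayInput d hq (z t)) (i + (d + 1)) =
      (1 / 2) ^ (d + 1) * x t.pred i := fun t i => by
    rw [lp.coeFn_add, Pi.add_apply, delayShift_apply_add, delayInput_apply,
      padded_of_le _ (by omega), mul_zero, add_zero]
  refine ⟨fun hx t i => ?_, fun hx t i => ?_⟩
  · induction i using Nat.strong_induction_on generalizing t with
    | _ i ih =>
      rcases lt_or_ge i (d + 1) with hi | hi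
      · rw [hx, hfirst t i hi]
      · obtain ⟨j, rfl⟩ := Nat.exists_eq_add_of_le' hi
        rw [hx, hnext, ih j (by omega), delayLine_add]
  · rcases lt_or_ge i (d + 1) with hi | hi
    · rw [hx, hfirst t i hi]
    · obtain ⟨j, rfl⟩ := Nat.exists_eq_add_of_le' hi
      rw [hx, hnext, hx, delayLine_add]

lemma isBoundedSolution_delay_iff (hq : q ≠ 0) {z : InputSeq d}
    (hz : BddAbove (Set.range fun t => ‖z t‖)) {x : ZMinus → SeqSpace q} :
    IsBoundedSolution id (delayShift d q) (delayInput d hq) 0 z x ↔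
      ∀ t i, x t i = delayLine z t i := by
  simp only [IsBoundedSolution, add_zero, id_eq, delay_recursion_iff hq, and_iff_right_iff_imp]
  intro hx
  obtain ⟨M, hM⟩ := hz
  have hgeom := (memℓp_geometric (r := (1 / 2 : ℝ)) (by norm_num) hq).const_mul M
  refine ⟨‖(⟨_, hgeom⟩ : SeqSpace q)‖, ?_⟩
  rintro _ ⟨t, rfl⟩
  refine lp.norm_mono hq fun i => ?_
  rw [hx]
  exact (norm_half_pow_mul_le ((norm_padded_le _ _).trans (hM ⟨_, rfl⟩)) i).trans (le_abs_self _)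

lemma existsUnique_isBoundedSolution_delay (hq : q ≠ 0) {z : InputSeq d}
    (hz : BddAbove (Set.range fun t => ‖z t‖)) :
    ∃! x : ZMinus → SeqSpace q,
      IsBoundedSolution id (delayShift d q) (delayInput d hq) 0 z x := by
  simp only [isBoundedSolution_delay_iff hq hz]
  obtain ⟨M, hM⟩ := hz
  have hmem : ∀ t, Memℓp (delayLine z t) q := fun t =>
    memℓp_half_pow_mul hq fun i => (norm_padded_le _ _).trans (hM ⟨_, rfl⟩)
  exact ⟨fun t => ⟨delayLine z t, hmem t⟩, fun _ _ => rfl,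
    fun x hx => funext fun t => lp.ext (funext (hx t))⟩

end DelayLine

section Readout

variable {d : ℕ} {p q : ℝ≥0∞}

/-- A finitely supported weight as an element of `ℓ^p`. -/
def finiteWeight (p : ℝ≥0∞) (α : ℕ →₀ ℝ) : SeqSpace p :=
  ⟨fun i => α i, (memℓp_zero (E := fun _ : ℕ => ℝ) (f := fun i => α i)
    α.hasFiniteSupport).of_exponent_ge zero_le⟩

lemma pairing_finiteWeight (α : ℕ →₀ ℝ) (x : SeqSpace q) :
    pairing (finiteWeight p α) x = Finsupp.linearCombination ℝ (x : ℕ → ℝ) α := by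
  change ∑' i, α i * x i = ∑ i ∈ α.support, α i * x i
  refine tsum_eq_sum fun i hi => ?_
  rw [Finsupp.notMem_support_iff.1 hi, zero_mul]

/-- The pre-activation without bias, `(a, c) ↦ a · x_{-1}(z) + c · z_0`, of a neuron reading the
delay line with finitely supported weights `a`. -/
def readout (I : Set (InputSeq d)) : (ℕ →₀ ℝ) × EuclideanSpace ℝ (Fin d) →ₗ[ℝ] I → ℝ :=
  .pi fun z => (Finsupp.linearCombination ℝ (delayLine z.1 ZMinus.zero.pred)).coprod
    ((innerₗ _).flip (z.1 ZMinus.zero))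

variable {I : Set (InputSeq d)}

lemma readout_apply (θ : (ℕ →₀ ℝ) × EuclideanSpace ℝ (Fin d)) (z : I) :
    readout I θ z = Finsupp.linearCombination ℝ (delayLine z.1 ZMinus.zero.pred) θ.1 +
      inner ℝ θ.2 (z.1 ZMinus.zero) := rfl

lemma delayLine_mul_add (z : InputSeq d) (t : ZMinus) (k : ℕ) (j : Fin d) :
    delayLine z t (k * (d + 1) + j) = (1 / 2) ^ (k * (d + 1) + j : ℕ) * z (t.back k) j := by
  have hj : (j : ℕ) < d + 1 := j.2.trans d.lt_succ_self
  rw [delayLine, Nat.mul_add_mod_of_lt hj, Nat.mul_comm k, Nat.mul_add_div d.succ_pos,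
    Nat.div_eq_of_lt hj, add_zero k, padded_val]

lemma exists_readout_eq_coord (I : Set (InputSeq d)) (t : ZMinus) (j : Fin d) :
    ∃ θ, ∀ z : I, readout I θ z = z.1 t j := by
  obtain rfl | ⟨k, rfl⟩ : t = ZMinus.zero ∨ ∃ k, t = ZMinus.zero.pred.back k := by
    rcases t.2.eq_or_lt with h | h
    · exact .inl (Subtype.ext h)
    · exact .inr ⟨(-1 - t.1).toNat, Subtype.ext (by
        simp only [ZMinus.back, ZMinus.pred, ZMinus.zero]; omega)⟩
  · exact ⟨(0, EuclideanSpace.single j 1), fun z => by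
      simp [readout_apply, EuclideanSpace.inner_single_left]⟩
  · refine ⟨(.single (k * (d + 1) + j) (2 ^ (k * (d + 1) + j : ℕ)), 0), fun z => ?_⟩
    simp [readout_apply, delayLine_mul_add]

lemma measurable_delayLine (t : ZMinus) (i : ℕ) :
    Measurable fun z : InputSeq d => delayLine z t i := by
  by_cases hi : i % (d + 1) < d
  · simp only [delayLine, padded_val _ ⟨_, hi⟩]
    fun_prop
  · simp only [delayLine, padded_of_le _ (not_lt.1 hi)]
    fun_prop

lemma measurable_readout (θ : (ℕ →₀ ℝ) × EuclideanSpace ℝ (Fin d)) : Measurable (readout I θ) := by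
  simp only [funext (readout_apply θ), Finsupp.linearCombination_apply, Finsupp.sum, smul_eq_mul]
  have hdelay : ∀ i, Measurable fun z : I => delayLine z.1 ZMinus.zero.pred i := fun i =>
    (measurable_delayLine _ i).comp measurable_subtype_coe
  have hinput : Measurable fun z : I => z.1 ZMinus.zero :=
    (measurable_pi_apply _).comp measurable_subtype_coe
  exact (Finset.measurable_sum _ fun i _ => (hdelay i).const_mul _).add (hinput.const_inner)

lemma measurableSpace_eq_comap_readout (I : Set (InputSeq d)) :
    (inferInstance : MeasurableSpace I) =
      MeasurableSpace.comap (fun z v => readout I v z) MeasurableSpace.pi := by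
  refine le_antisymm ?_ (measurable_iff_comap_le.1 (measurable_pi_iff.2 measurable_readout))
  let _ : MeasurableSpace I := MeasurableSpace.comap (fun z v => readout I v z) MeasurableSpace.pi
  refine measurable_iff_comap_le.1 (measurable_pi_iff.2 fun t => ?_)
  have hcoord : ∀ j, Measurable fun z : I => z.1 t j := fun j => by
    obtain ⟨θ, hθ⟩ := exists_readout_eq_coord I t j
    simp only [← hθ]
    exact measurable_pi_iff.1 (comap_measurable fun (z : I) v => readout I v z) θ
  exact (WithLp.measurable_toLp 2 _).comp (measurable_pi_iff.2 hcoord)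

end Readout

section BarronClass

variable {d : ℕ} {p q : ℝ≥0∞}

lemma exists_isProbabilityMeasure_integral_eq_average {ι X F : Type*} [MeasurableSpace X]
    [MeasurableSingletonClass X] [NormedAddCommGroup F] [NormedSpace ℝ F] [CompleteSpace F]
    {s : Finset ι} (hs : s.Nonempty) (P : ι → X) :
    ∃ μ : Measure X, IsProbabilityMeasure μ ∧ ∀ f : X → F, Integrable f μ ∧
      ∫ x, f x ∂μ = (s.card : ℝ)⁻¹ • ∑ i ∈ s, f (P i) := by
  have hcard : (s.card : ℝ≥0∞) ≠ 0 := Nat.cast_ne_zero.2 hs.card_pos.ne'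
  have hdirac : ∀ (f : X → F), ∀ i ∈ s, Integrable f (Measure.dirac (P i)) := fun f i _ =>
    integrable_dirac (by simp)
  refine ⟨(s.card : ℝ≥0∞)⁻¹ • ∑ i ∈ s, Measure.dirac (P i), ⟨?_⟩, fun f => ⟨?_, ?_⟩⟩
  · simp [ENNReal.inv_mul_cancel hcard]
  · exact (integrable_finsetSum_measure.2 (hdirac f)).smul_measure (ENNReal.inv_ne_top.2 hcard)
  · rw [integral_smul_measure, integral_finsetSum_measure (hdirac f)]
    simp

instance [Fact (1 ≤ p)] : T2Space (ParamSpace p d) :=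
  inferInstanceAs (T2Space (ℝ × SeqSpace p × EuclideanSpace ℝ (Fin d) × ℝ))

lemma mem_barronClass_of_mem_ridgeSpan [Fact (1 ≤ p)] (hq : q ≠ 0) {σ : ℝ → ℝ}
    {I : Set (InputSeq d)} (hI : ∀ z ∈ I, BddAbove (Set.range fun t => ‖z t‖)) {H : I → ℝ}
    (hH : H ∈ ridgeSpan (readout I) σ) : H ∈ barronClass p q id σ I := by
  classical
  obtain ⟨c, rfl⟩ := Finsupp.mem_span_range_iff_exists_finsupp.1 hH
  set s := insert 0 c.support
  have hs : s.Nonempty := Finset.insert_nonempty _ _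
  obtain ⟨μ, hμ, hint⟩ := exists_isProbabilityMeasure_integral_eq_average (F := ℝ) hs
    fun θ => show ParamSpace p d from (s.card * c θ, finiteWeight p θ.1.1, θ.1.2, θ.2)
  refine ⟨μ, 0, delayShift d q, delayInput d hq, hμ,
    fun z => existsUnique_isBoundedSolution_delay hq (hI z z.2), (hint _).1.lintegral_lt_top,
    fun z x hx => ⟨(hint _).1, ?_⟩⟩
  have hstate : (x ZMinus.zero.pred : ℕ → ℝ) = delayLine z.1 ZMinus.zero.pred :=
    funext ((isBoundedSolution_delay_iff hq (hI z z.2)).1 hx _)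
  have hcard : (s.card : ℝ) ≠ 0 := Nat.cast_ne_zero.2 hs.card_pos.ne'
  rw [(hint _).2, Finsupp.sum_of_support_subset c (Finset.subset_insert _ _) _ (by simp),
    Finset.sum_apply, Finset.smul_sum]
  refine Finset.sum_congr rfl fun θ _ => ?_
  simp only [ParamSpace.w, ParamSpace.a, ParamSpace.c, ParamSpace.b, pairing_finiteWeight, hstate,
    ← readout_apply, Pi.smul_apply, smul_eq_mul, mul_assoc, inv_mul_cancel_left₀ hcard]

end BarronClass

lemma exists_bounded_mem_rescalingSpan {σ : ℝ → ℝ}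
    (hσ : (∀ x, σ x = max x 0) ∨
      ((∃ M, ∀ x, |σ x| ≤ M) ∧ Continuous σ ∧ ∃ x y, σ x ≠ σ y)) :
    ∃ τ ∈ rescalingSpan σ, (∃ M, ∀ x, |τ x| ≤ M) ∧ Continuous τ ∧ ∃ x y, τ x ≠ τ y := by
  rcases hσ with hrelu | hbounded
  · obtain rfl : σ = fun x => max x 0 := funext hrelu
    refine ⟨fun x => max (x + 1) 0 - max x 0, sub_mem (Submodule.subset_span ⟨(1, 1), by simp⟩)
      (mem_rescalingSpan_self _), ⟨1, fun x => ?_⟩, by fun_prop, -1, 0, by norm_num⟩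
    simpa using abs_max_sub_max_le_abs (x + 1) x 0
  · exact ⟨σ, mem_rescalingSpan_self σ, hbounded⟩

end RecurrentBarron

end

theorem proposition2p9_general
    (p q : ℝ≥0∞) [Fact (1 ≤ p)] (hq : q ≠ 0) (σ τ : ℝ → ℝ)
    (hτ : τ ∈ RecurrentBarron.rescalingSpan σ) (hbdd : ∃ M, ∀ x, |τ x| ≤ M)
    (hcont : Continuous τ) (hne : ∃ x y, τ x ≠ τ y)
    (d : ℕ) (I : Set (RecurrentBarron.InputSeq d))
    (hI : ∀ z ∈ I, BddAbove (Set.range fun t => ‖z t‖))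
    (γ : Measure I) [IsFiniteMeasure γ] (r : ℝ≥0∞) [Fact (1 ≤ r)] (hr : r ≠ ∞) :
    Dense {f : Lp ℝ r γ | ∃ H ∈ RecurrentBarron.barronClass p q id σ I,
      ∃ hH : MemLp H r γ, hH.toLp H = f} := by
  obtain ⟨M, hM⟩ := hbdd
  refine (RecurrentBarron.dense_lpOfSubmodule_ridgeSpan
    (RecurrentBarron.measurableSpace_eq_comap_readout I) hr hτ hcont hM hne).mono ?_
  rintro f ⟨H, hH, hHf⟩
  exact ⟨H, RecurrentBarron.mem_barronClass_of_mem_ridgeSpan hq hI hH, hHf⟩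

theorem proposition2p9
    (p q : ℝ≥0∞) [Fact (1 ≤ p)] (hpq : p.HolderConjugate q)
    (σ₁ σ₂ : ℝ → ℝ) (hσ₁ : ∀ x, σ₁ x = x)
    (hσ₂ : (∀ x, σ₂ x = max x 0) ∨
      ((∃ M, ∀ x, |σ₂ x| ≤ M) ∧ Continuous σ₂ ∧ ∃ x y, σ₂ x ≠ σ₂ y))
    (d : ℕ) (D : Set (EuclideanSpace ℝ (Fin d)))
    (I : Set (RecurrentBarron.InputSeq d)) (hI : I ⊆ RecurrentBarron.boundedInputs D)
    (γ : Measure I) [IsProbabilityMeasure γ]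
    (pbar : ℝ≥0∞) [Fact (1 ≤ pbar)] (hpbar : pbar ≠ ∞) :
    Dense {f : Lp ℝ pbar γ | ∃ H ∈ RecurrentBarron.barronClass p q σ₁ σ₂ I,
      ∃ hH : MemLp H pbar γ, hH.toLp H = f} := by
  obtain rfl : σ₁ = id := funext hσ₁
  obtain ⟨τ, hτ, hbdd, hcont, hne⟩ := RecurrentBarron.exists_bounded_mem_rescalingSpan hσ₂
  exact proposition2p9_general p q hpq.symm.ne_zero σ₂ τ hτ hbdd hcont hne d I
    (fun z hz => (hI hz).2) γ pbar hpbar
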